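/- Let $\|\cdot\|$ be the Euclidean norm on $\mathbb{R}^d$, let $\mathcal{B}=\{x\in\mathbb{R}^d:\|x\|\le 1\}$ be the unit ball, and for a list $L$ of points of $\mathbb{R}^d$ let $$\mathcal{V}_L=\bigcap_{v\in L}\{x\in\mathbb{R}^d:\|x\|\le\|x-v\|\}.$$ Fix $\alpha>1$ and, for every $d$, let $L$ consist of $n$ independent uniformly random points of $\mathcal{B}$, where $n=\alpha^d$, rounded up or down to an integer. Then there is a deterministic sequence $\delta_d=o(d)$ (which may depend on $\alpha$ and on the rounding) such that, with probability $1-o(1)$ as $d\to\infty$: * if $\alpha\le\sqrt2$, then $\operatorname{vol}(\mathcal{V}_L)=\left(\dfrac{\alpha^2}{4\alpha^2-4}\right)^{d/2}e^{t}\,\operatorname{vol}(\mathcal{B})$ for some real $t$ with $|t|\le\delta_d$; * if $\alpha\ge\sqrt2$, then $\operatorname{vol}(\mathcal{V}_L)=\left(\dfrac{1}{\alpha^2}\right)^{d/2}e^{t}\,\operatorname{vol}(\mathcal{B})$ for some real $t$ with $|t|\le\delta_d$. That is, $\operatorname{vol}(\mathcal{V}_L)=c^{d/2+o(d)}\operatorname{vol}(\mathcal{B})$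 with $c=\frac{\alpha^2}{4\alpha^2-4}$ and $c=\frac1{\alpha^2}$ respectively, where $c^{d/2+o(d)}$ is read as $c^{d/2}e^{o(d)}$ (which matters only when $c=1$, i.e. $\alpha=2/\sqrt3$). -/

import Mathlib

open MeasureTheory

/-- The half-space `H_v = {x ∈ ℝ^d : ‖x‖ ≤ ‖x - v‖}`, with the Euclidean norm. -/
def halfSpace {d : ℕ} (v : EuclideanSpace ℝ (Fin d)) : Set (EuclideanSpace ℝ (Fin d)) :=
  {x | ‖x‖ ≤ ‖x - v‖}

/-- The convex polytope `V_L = ⋂_{v ∈ L} H_v`. -/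
def polytope {d : ℕ} (L : Set (EuclideanSpace ℝ (Fin d))) : Set (EuclideanSpace ℝ (Fin d)) :=
  ⋂ v ∈ L, halfSpace v

/-- The closed unit ball of `ℝ^d`. -/
def unitBall (d : ℕ) : Set (EuclideanSpace ℝ (Fin d)) :=
  {x | ‖x‖ ≤ 1}

/-- The uniform distribution on the unit ball: `A ↦ vol (A ∩ B) / vol B`. -/
noncomputable def uniformBall (d : ℕ) : Measure (EuclideanSpace ℝ (Fin d)) :=
  ProbabilityTheory.cond volume (unitBall d)

theorem unitBall_eq_closedBall (d : ℕ) : unitBall d = Metric.closedBall 0 1 := by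
  ext x
  simp [unitBall]

instance uniformBall_isProbabilityMeasure (d : ℕ) : IsProbabilityMeasure (uniformBall d) := by
  unfold uniformBall
  rw [unitBall_eq_closedBall]
  exact ProbabilityTheory.cond_isProbabilityMeasure_of_finite
    (Metric.measure_closedBall_pos volume _ one_pos).ne' measure_closedBall_lt_top.ne

/-- The joint law of `n` independent uniform points of the unit ball of `ℝ^d`. -/
noncomputable def uniformList (d n : ℕ) : Measure (Fin n → EuclideanSpace ℝ (Fin d)) :=
  Measure.pi fun _ => uniformBall d

/-- `vol (V_L) = c ^ (d / 2) * exp t * vol B` for some real `t` with `|t| ≤ δ`. With `δ = o(d)` this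
is `vol (V_L) = c ^ (d / 2 + o(d)) * vol B` (with the usual reading `exp (o(d))` if `c = 1`).
In particular the volume is then finite and positive. -/
def VolumeIsPow {d : ℕ} (c δ : ℝ) (L : Set (EuclideanSpace ℝ (Fin d))) : Prop :=
  ∃ t : ℝ, |t| ≤ δ ∧
    volume (polytope L) = ENNReal.ofReal (c ^ ((d : ℝ) / 2) * Real.exp t) * volume (unitBall d)

/-! A random point `v` cuts off `x` exactly when it falls in the lens common to the unit ball and
the open ball of radius `‖x‖` about `x`. In high dimension the relative volume of the lens is, up to
a factor `exp (o(d))`, `p ^ d`, where `p` is the radius of its largest cross-section orthogonal to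
`x`: for `r = ‖x‖`, `p = r` if `r ≤ 1/√2` and `p = √(1 - 1/(4r²))` if `r ≥ 1/√2`. The critical
radius `ρ` solves `p = 1/α`; the two regimes of `p` give the two formulas, meeting at `α = √2`.

Below `ρ`, the expected number of cuts `n p ^ d` tends to 0, so by Markov most of the ball survives
(`uniformBall_cut_le`, `uniformList_volume_cut_le`). Above `ρ`, a point survives with probability at
most about `exp (-n p ^ d)`, doubly exponentially small, which beats any volume ratio `K ^ d`
(`le_uniformBall_cut`, `uniformList_volume_annulus_le`). This controls only a bounded annulus;
convexity excludes anything beyond it (`polytope_subset_closedBall`). -/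

/-! ### Volumes of balls and the uniform law -/

theorem measurableSet_unitBall (d : ℕ) : MeasurableSet (unitBall d) := by
  rw [unitBall_eq_closedBall]
  exact measurableSet_closedBall

theorem volume_unitBall_ne_zero (d : ℕ) : volume (unitBall d) ≠ 0 := by
  rw [unitBall_eq_closedBall]
  exact (Metric.measure_closedBall_pos volume _ one_pos).ne'

theorem volume_unitBall_ne_top (d : ℕ) : volume (unitBall d) ≠ ⊤ := by
  rw [unitBall_eq_closedBall]
  exact measure_closedBall_lt_top.ne

theorem volume_closedBall_eq {d : ℕ} (x : EuclideanSpace ℝ (Fin d)) {r : ℝ} (hr : 0 ≤ r) :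
    volume (Metric.closedBall x r) = ENNReal.ofReal (r ^ d) * volume (unitBall d) := by
  rw [unitBall_eq_closedBall, Measure.addHaar_closedBall' volume x hr, finrank_euclideanSpace_fin]

theorem uniformBall_apply {d : ℕ} (A : Set (EuclideanSpace ℝ (Fin d))) :
    uniformBall d A = (volume (unitBall d))⁻¹ * volume (unitBall d ∩ A) :=
  ProbabilityTheory.cond_apply (measurableSet_unitBall d) _ _

theorem uniformBall_le_of_subset {d : ℕ} {A : Set (EuclideanSpace ℝ (Fin d))}
    {c : EuclideanSpace ℝ (Fin d)} {r : ℝ} (hr : 0 ≤ r)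
    (h : unitBall d ∩ A ⊆ Metric.closedBall c r) :
    uniformBall d A ≤ ENNReal.ofReal (r ^ d) := by
  rw [uniformBall_apply, mul_comm, ← div_eq_mul_inv]
  refine ENNReal.div_le_of_le_mul ((measure_mono h).trans (volume_closedBall_eq c hr).le)

theorem le_uniformBall_of_subset {d : ℕ} {A S : Set (EuclideanSpace ℝ (Fin d))} {a : ENNReal}
    (ha : a * volume (unitBall d) ≤ volume S) (h : S ⊆ unitBall d ∩ A) :
    a ≤ uniformBall d A := by
  rw [uniformBall_apply, mul_comm, ← div_eq_mul_inv]
  exact (ENNReal.le_div_iff_mul_le (Or.inl (volume_unitBall_ne_zero d))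
    (Or.inl (volume_unitBall_ne_top d))).2 (ha.trans (measure_mono h))

/-! ### Half-spaces and convexity of the polytope -/

theorem mem_halfSpace_iff {d : ℕ} {x v : EuclideanSpace ℝ (Fin d)} :
    x ∈ halfSpace v ↔ 2 * inner ℝ x v ≤ ‖v‖ ^ 2 := by
  have h := norm_sub_sq_real x v
  have h1 := norm_nonneg x
  have h2 := norm_nonneg (x - v)
  change ‖x‖ ≤ ‖x - v‖ ↔ _
  rw [← sq_le_sq₀ h1 h2, h]
  constructor <;> intro h' <;> linarith

theorem mem_polytope_iff {d : ℕ} {x : EuclideanSpace ℝ (Fin d)}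
    {L : Set (EuclideanSpace ℝ (Fin d))} :
    x ∈ polytope L ↔ ∀ v ∈ L, 2 * inner ℝ x v ≤ ‖v‖ ^ 2 := by
  simp [polytope, mem_halfSpace_iff]

theorem convex_polytope {d : ℕ} (L : Set (EuclideanSpace ℝ (Fin d))) : Convex ℝ (polytope L) := by
  intro x hx y hy a b ha hb hab
  rw [mem_polytope_iff] at *
  intro v hv
  rw [inner_add_left, inner_smul_left, inner_smul_left]
  have h1 := mul_le_mul_of_nonneg_left (hx v hv) ha
  have h2 := mul_le_mul_of_nonneg_left (hy v hv) hb
  have h3 : ‖v‖ ^ 2 = a * ‖v‖ ^ 2 + b * ‖v‖ ^ 2 := by rw [← add_mul, hab, one_mul]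
  simp only [conj_trivial]
  linarith

theorem zero_mem_polytope {d : ℕ} (L : Set (EuclideanSpace ℝ (Fin d))) : 0 ∈ polytope L := by
  rw [mem_polytope_iff]
  intro v _
  simp

theorem closedBall_subset_polytope {d : ℕ} {L : Set (EuclideanSpace ℝ (Fin d))} {κ : ℝ}
    (h : ∀ v ∈ L, 2 * κ ≤ ‖v‖) : Metric.closedBall 0 κ ⊆ polytope L := by
  intro x hx
  rw [mem_polytope_iff]
  intro v hv
  have h1 := real_inner_le_norm x v
  have h2 : ‖x‖ ≤ κ := by simpa using hx
  nlinarith [h v hv, norm_nonneg v, norm_nonneg x]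

/-! ### The volume of the lens of cutting points -/

/-- The points `v` that cut off `x` lie in a small ball when `x` is close to the origin. -/
theorem uniformBall_cut_le {d : ℕ} {t r : ℝ} (ht0 : 0 ≤ t) (ht1 : t ≤ 1)
    {x : EuclideanSpace ℝ (Fin d)} (hx : ‖x‖ ≤ r) :
    uniformBall d {v | x ∉ halfSpace v} ≤ ENNReal.ofReal (√(1 - t + t ^ 2 * r ^ 2) ^ d) := by
  refine uniformBall_le_of_subset (c := t • x) (Real.sqrt_nonneg _) ?_
  rintro v ⟨hv1, hv2⟩
  simp only [Set.mem_ofPred_eq, mem_halfSpace_iff, not_le, unitBall] at hv1 hv2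
  rw [mem_closedBall_iff_norm]
  refine Real.le_sqrt_of_sq_le ?_
  rw [norm_sub_sq_real, norm_smul, inner_smul_right, Real.norm_of_nonneg ht0, mul_pow,
    real_inner_comm]
  have h1 : ‖v‖ ^ 2 ≤ 1 := by nlinarith [norm_nonneg v]
  have h2 : ‖x‖ ^ 2 ≤ r ^ 2 := by nlinarith [norm_nonneg x]
  -- Weight `1 - t` on `‖v‖² ≤ 1` and weight `t` on `‖v‖² < 2⟪x, v⟫`.
  nlinarith [mul_le_mul_of_nonneg_left h2 (sq_nonneg t), mul_le_mul_of_nonneg_left hv2.le ht0,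
    mul_le_mul_of_nonneg_left h1 (sub_nonneg.2 ht1)]

/-- The part of a ball near its equator carries all but a small part of its volume. -/
theorem volume_slab_ge {d : ℕ} (c e : EuclideanSpace ℝ (Fin d)) (he : ‖e‖ = 1) {q η : ℝ}
    (hq : 0 ≤ q) (hη : 0 ≤ η) (hd : 4 * √(q ^ 2 - η ^ 2) ^ d ≤ q ^ d) :
    ENNReal.ofReal (q ^ d / 2) * volume (unitBall d) ≤
      volume {y | ‖y - c‖ ≤ q ∧ |inner ℝ (y - c) e| ≤ η} := by
  set S := {y | ‖y - c‖ ≤ q ∧ |inner ℝ (y - c) e| ≤ η}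
  set q' := √(q ^ 2 - η ^ 2)
  have hq' : 0 ≤ q' := Real.sqrt_nonneg _
  -- Each of the two caps beyond the slab fits in a ball of radius `q'` about `c ± η • e`; by `hd`
  -- each such ball has at most a quarter of the volume.
  have hsub : Metric.closedBall c q ⊆
      S ∪ (Metric.closedBall (c + η • e) q' ∪ Metric.closedBall (c - η • e) q') := by
    intro y hy
    rw [mem_closedBall_iff_norm] at hy
    have hy2 : ‖y - c‖ ^ 2 ≤ q ^ 2 := by nlinarith [norm_nonneg (y - c)]
    by_cases hS : |inner ℝ (y - c) e| ≤ η
    · exact Or.inl ⟨hy, hS⟩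
    · right
      rw [not_le, lt_abs] at hS
      rcases hS with hS | hS
      · left
        rw [mem_closedBall_iff_norm, ← sub_sub]
        refine Real.le_sqrt_of_sq_le ?_
        rw [norm_sub_sq_real, norm_smul, inner_smul_right, Real.norm_of_nonneg hη, he]
        nlinarith
      · right
        rw [mem_closedBall_iff_norm, ← sub_add]
        refine Real.le_sqrt_of_sq_le ?_
        rw [norm_add_sq_real, norm_smul, inner_smul_right, Real.norm_of_nonneg hη, he]
        nlinarith
  have h := (measure_mono (μ := volume) hsub).trans ((measure_union_le _ _).trans
    (add_le_add_right (measure_union_le _ _) _))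
  rw [volume_closedBall_eq _ hq, volume_closedBall_eq _ hq', volume_closedBall_eq _ hq',
    ← add_mul, ← ENNReal.ofReal_add (by positivity) (by positivity)] at h
  have h2 : ENNReal.ofReal (q ^ d) * volume (unitBall d) ≤
      volume S + ENNReal.ofReal (q ^ d / 2) * volume (unitBall d) := by
    refine h.trans ?_
    gcongr
    linarith
  have h3 : ENNReal.ofReal (q ^ d) * volume (unitBall d) =
      ENNReal.ofReal (q ^ d / 2) * volume (unitBall d) +
        ENNReal.ofReal (q ^ d / 2) * volume (unitBall d) := by
    rw [← add_mul, ← ENNReal.ofReal_add (by positivity) (by positivity), add_halves]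
  rw [h3] at h2
  exact (ENNReal.add_le_add_iff_right
    (ENNReal.mul_ne_top ENNReal.ofReal_ne_top (volume_unitBall_ne_top d))).1 h2

/-- The equatorial slab of the ball of radius `q` about `s • e`, with `e` the direction of `x`, lies
in the lens: `h1` keeps it in the unit ball, `h2` makes its points cut off `x`. A full ball might
stick out of the lens; the slab carries half its volume. -/
theorem le_uniformBall_cut {d : ℕ} {s q η r : ℝ} (hs : 0 ≤ s) (hq : 0 ≤ q) (hη : 0 ≤ η)
    (hηs : η ≤ s) (hr : 0 < r) (h1 : q ^ 2 + 2 * s * η + s ^ 2 ≤ 1)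
    (h2 : q ^ 2 + 2 * s * η + s ^ 2 < 2 * r * (s - η))
    (hd : 4 * √(q ^ 2 - η ^ 2) ^ d ≤ q ^ d)
    {x : EuclideanSpace ℝ (Fin d)} (hx : r ≤ ‖x‖) :
    ENNReal.ofReal (q ^ d / 2) ≤ uniformBall d {v | x ∉ halfSpace v} := by
  have hx0 : 0 < ‖x‖ := hr.trans_le hx
  set e := ‖x‖⁻¹ • x
  have he : ‖e‖ = 1 := by
    rw [norm_smul, norm_inv, norm_norm, inv_mul_cancel₀ hx0.ne']
  have hxe : x = ‖x‖ • e := by rw [smul_smul, mul_inv_cancel₀ hx0.ne', one_smul]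
  refine le_uniformBall_of_subset (volume_slab_ge (s • e) e he hq hη hd) ?_
  rintro y ⟨hy1, hy2⟩
  set z := y - s • e
  have hyz : y = z + s • e := by simp [z]
  have hz2 : ‖z‖ ^ 2 ≤ q ^ 2 := by nlinarith [norm_nonneg z]
  have hy : ‖y‖ ^ 2 ≤ q ^ 2 + 2 * s * η + s ^ 2 := by
    rw [hyz, norm_add_sq_real, norm_smul, inner_smul_right, Real.norm_of_nonneg hs, he]
    nlinarith [abs_le.1 hy2]
  constructor
  · change ‖y‖ ≤ 1
    nlinarith [norm_nonneg y]
  · simp only [Set.mem_ofPred_eq, mem_halfSpace_iff, not_le]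
    have hin : inner ℝ x y = ‖x‖ * (inner ℝ z e + s) := by
      conv_lhs => rw [hxe, hyz]
      rw [inner_smul_left, inner_add_right, inner_smul_right, real_inner_self_eq_norm_sq, he,
        real_inner_comm]
      simp
    rw [hin]
    have h3 : s - η ≤ inner ℝ z e + s := by linarith [(abs_le.1 hy2).1]
    have h4 : r * (s - η) ≤ ‖x‖ * (inner ℝ z e + s) :=
      mul_le_mul hx h3 (by linarith) hx0.le
    linarith

/-! ### Deterministic volume bounds -/

/-- If a convex set contains `0`, a small ball around `0` and no small ball inside an annulus,
then it stays inside the annulus. -/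
theorem polytope_subset_closedBall {d : ℕ} {L : Set (EuclideanSpace ℝ (Fin d))} {κ r : ℝ}
    (hκ : 0 < κ) (hκr : κ ≤ r) (h : ∀ v ∈ L, 2 * κ ≤ ‖v‖)
    (hvol : volume {x | (r ≤ ‖x‖ ∧ ‖x‖ ≤ 4 * r) ∧ x ∈ polytope L} <
      ENNReal.ofReal ((κ / 2) ^ d) * volume (unitBall d)) :
    polytope L ⊆ Metric.closedBall 0 (4 * r) := by
  intro y hy
  by_contra hfar
  rw [mem_closedBall_zero_iff, not_le] at hfar
  have hy0 : 0 < ‖y‖ := by linarith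
  set a := 2 * r / ‖y‖
  have ha0 : 0 ≤ a := div_nonneg (by linarith) hy0.le
  have ha1 : a ≤ 1 / 2 := by
    rw [div_le_iff₀ hy0]
    linarith
  have hay : ‖a • y‖ = 2 * r := by
    rw [norm_smul, Real.norm_of_nonneg ha0, div_mul_cancel₀ _ hy0.ne']
  -- The ball of radius `κ / 2` about `a • y` lies in the annulus, and in the polytope as the set of
  -- midpoints between the inner ball of radius `κ` and `(2 * a) • y`.
  refine hvol.not_ge ?_
  rw [← volume_closedBall_eq (a • y) (by positivity)]
  refine measure_mono fun w hw => ?_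
  rw [mem_closedBall_iff_norm] at hw
  refine ⟨?_, ?_⟩
  · have h1 := abs_le.1 ((abs_norm_sub_norm_le w (a • y)).trans hw)
    rw [hay] at h1
    constructor <;> linarith [h1.1, h1.2]
  · have hz : (2 : ℝ) • (w - a • y) ∈ polytope L := by
      refine closedBall_subset_polytope h ?_
      rw [mem_closedBall_zero_iff, norm_smul, Real.norm_of_nonneg zero_le_two]
      linarith
    have h2y : (2 * a) • y ∈ polytope L := by
      have := convex_polytope L hy (zero_mem_polytope L) (a := 2 * a) (b := 1 - 2 * a)
        (by linarith) (by linarith) (by ring)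
      simpa using this
    have := convex_polytope L hz h2y (a := 1 / 2) (b := 1 / 2)
        (by norm_num) (by norm_num) (by norm_num)
    rw [smul_smul, smul_smul] at this
    convert this using 1
    norm_num
    ring_nf
    simp

theorem volume_polytope_le {d : ℕ} {L : Set (EuclideanSpace ℝ (Fin d))} {κ r : ℝ}
    (hκ : 0 < κ) (hκr : κ ≤ r) (h : ∀ v ∈ L, 2 * κ ≤ ‖v‖)
    (hvol : volume {x | (r ≤ ‖x‖ ∧ ‖x‖ ≤ 4 * r) ∧ x ∈ polytope L} <
      ENNReal.ofReal ((κ / 2) ^ d) * volume (unitBall d)) :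
    volume (polytope L) ≤ ENNReal.ofReal (2 * r ^ d) * volume (unitBall d) := by
  have hsub := polytope_subset_closedBall hκ hκr h hvol
  have hr : 0 < r := hκ.trans_le hκr
  have hsub2 : polytope L ⊆ Metric.closedBall 0 r ∪
      {x | (r ≤ ‖x‖ ∧ ‖x‖ ≤ 4 * r) ∧ x ∈ polytope L} := by
    intro x hx
    rcases le_total ‖x‖ r with hxr | hxr
    · exact Or.inl (by simpa using hxr)
    · exact Or.inr ⟨⟨hxr, by simpa using hsub hx⟩, hx⟩
  refine (measure_mono hsub2).trans ((measure_union_le _ _).trans ?_)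
  rw [two_mul, ENNReal.ofReal_add (by positivity) (by positivity), add_mul,
    volume_closedBall_eq _ hr.le]
  gcongr
  refine hvol.le.trans ?_
  gcongr
  linarith

theorem volume_polytope_ge {d : ℕ} {L : Set (EuclideanSpace ℝ (Fin d))} {r : ℝ} (hr : 0 ≤ r)
    (hvol : volume {x | ‖x‖ ≤ r ∧ x ∉ polytope L} ≤
      ENNReal.ofReal (r ^ d / 2) * volume (unitBall d)) :
    ENNReal.ofReal (r ^ d / 2) * volume (unitBall d) ≤ volume (polytope L) := by
  have hsub : Metric.closedBall 0 r ⊆ polytope L ∪ {x | ‖x‖ ≤ r ∧ x ∉ polytope L} := by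
    intro x hx
    by_cases h : x ∈ polytope L
    · exact Or.inl h
    · exact Or.inr ⟨by simpa using hx, h⟩
  have h := ((measure_mono (μ := volume) hsub).trans (measure_union_le _ _)).trans (add_le_add_right hvol _)
  rw [volume_closedBall_eq _ hr, ← add_halves (r ^ d),
    ENNReal.ofReal_add (by positivity) (by positivity), add_mul] at h
  rw [add_halves] at h
  exact (ENNReal.add_le_add_iff_right
    (ENNReal.mul_ne_top ENNReal.ofReal_ne_top (volume_unitBall_ne_top d))).1 h

theorem volumeIsPow_of_bounds {d : ℕ} {L : Set (EuclideanSpace ℝ (Fin d))} {ρ ε : ℝ} (hρ : 0 < ρ)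
    (hlow : ENNReal.ofReal ((ρ * Real.exp (-ε)) ^ d / 2) * volume (unitBall d) ≤
      volume (polytope L))
    (hup : volume (polytope L) ≤
      ENNReal.ofReal (2 * (ρ * Real.exp ε) ^ d) * volume (unitBall d)) :
    VolumeIsPow (ρ ^ 2) (ε * d + Real.log 2) L := by
  have hB0 := volume_unitBall_ne_zero d
  have hBt := volume_unitBall_ne_top d
  have hfin : volume (polytope L) ≠ ⊤ :=
    (hup.trans_lt (ENNReal.mul_lt_top ENNReal.ofReal_lt_top hBt.lt_top)).ne
  set w := (volume (polytope L) / volume (unitBall d)).toReal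
  have hw : volume (polytope L) = ENNReal.ofReal w * volume (unitBall d) := by
    rw [ENNReal.ofReal_toReal (ENNReal.div_ne_top hfin hB0), ENNReal.div_mul_cancel hB0 hBt]
  have hw0 : 0 ≤ w := ENNReal.toReal_nonneg
  rw [hw] at hlow hup
  have h1 : (ρ * Real.exp (-ε)) ^ d / 2 ≤ w :=
    (ENNReal.ofReal_le_ofReal_iff hw0).1 ((ENNReal.mul_le_mul_iff_left hB0 hBt).1 hlow)
  have h2 : w ≤ 2 * (ρ * Real.exp ε) ^ d :=
    (ENNReal.ofReal_le_ofReal_iff (by positivity)).1 ((ENNReal.mul_le_mul_iff_left hB0 hBt).1 hup)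
  have hwpos : 0 < w := lt_of_lt_of_le (by positivity) h1
  have hpow : (ρ ^ 2) ^ ((d : ℝ) / 2) = ρ ^ d := by
    rw [← Real.rpow_natCast ρ 2, ← Real.rpow_mul hρ.le, ← Real.rpow_natCast ρ d]
    congr 1
    push_cast
    ring
  have hexp : ∀ u : ℝ, (ρ * Real.exp u) ^ d = ρ ^ d * Real.exp (u * d) := by
    intro u
    rw [mul_pow, ← Real.exp_nat_mul, mul_comm u]
  have hρd : 0 < ρ ^ d := by positivity
  refine ⟨Real.log (w / ρ ^ d), ?_, ?_⟩
  · rw [hexp] at h1 h2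
    rw [abs_le]
    constructor
    · rw [Real.le_log_iff_exp_le (by positivity), le_div_iff₀ hρd, neg_add, Real.exp_add,
        Real.exp_neg (Real.log 2), Real.exp_log two_pos, ← neg_mul]
      linarith
    · rw [Real.log_le_iff_le_exp (by positivity), div_le_iff₀ hρd, Real.exp_add,
        Real.exp_log two_pos]
      linarith
  · rw [hw, hpow, Real.exp_log (by positivity), mul_div_cancel₀ _ hρd.ne']

theorem VolumeIsPow.mono {d : ℕ} {L : Set (EuclideanSpace ℝ (Fin d))} {c δ δ' : ℝ}
    (h : VolumeIsPow c δ L) (hδ : δ ≤ δ') : VolumeIsPow c δ' L := by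
  obtain ⟨t, ht, h⟩ := h
  exact ⟨t, ht.trans hδ, h⟩

/-! ### Probability bounds for random lists -/

instance uniformList_isProbabilityMeasure (d n : ℕ) : IsProbabilityMeasure (uniformList d n) := by
  unfold uniformList
  infer_instance

/-- Markov's inequality for the volume of a random set. -/
theorem measure_le_volume_section_le {Ω E : Type*} [MeasurableSpace Ω] [MeasurableSpace E]
    (P : Measure Ω) [SFinite P] (ν : Measure E) [SFinite ν] {T : Set (Ω × E)}
    (hT : MeasurableSet T) {S : Set E} (hS : MeasurableSet S) (hTS : ∀ p ∈ T, p.2 ∈ S)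
    {b : ENNReal} (hb : ∀ x ∈ S, P {L | (L, x) ∈ T} ≤ b) {a : ENNReal} (ha : a ≠ 0)
    (ha' : a ≠ ⊤) :
    P {L | a ≤ ν {x | (L, x) ∈ T}} ≤ b * ν S / a := by
  refine (meas_ge_le_lintegral_div (measurable_measure_prodMk_left hT).aemeasurable ha ha').trans ?_
  gcongr
  have h1 : ∫⁻ L, ν (Prod.mk L ⁻¹' T) ∂P = (P.prod ν) T := (Measure.prod_apply hT).symm
  rw [h1, Measure.prod_apply_symm hT, ← lintegral_indicator_const hS]
  refine lintegral_mono fun x => ?_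
  by_cases hx : x ∈ S
  · rw [Set.indicator_of_mem hx]
    exact hb x hx
  · have : (fun L => (L, x)) ⁻¹' T = ∅ := by
      ext L
      simp only [Set.mem_preimage, Set.mem_empty_iff_false, iff_false]
      exact fun h => hx (hTS _ h)
    simp [this]

theorem isClosed_mem_polytope_range (d n : ℕ) :
    IsClosed {p : (Fin n → EuclideanSpace ℝ (Fin d)) × EuclideanSpace ℝ (Fin d) |
      p.2 ∈ polytope (Set.range p.1)} := by
  simp only [mem_polytope_iff, Set.forall_mem_range, Set.ofPred_forall]
  refine isClosed_iInter fun i => isClosed_le ?_ ?_ <;> fun_prop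

theorem isClosed_mem_halfSpace {d : ℕ} (x : EuclideanSpace ℝ (Fin d)) :
    IsClosed {v | x ∈ halfSpace v} := by
  simp only [mem_halfSpace_iff]
  exact isClosed_le (by fun_prop) (by fun_prop)

theorem mem_polytope_range {d n : ℕ} {x : EuclideanSpace ℝ (Fin d)}
    {L : Fin n → EuclideanSpace ℝ (Fin d)} :
    x ∈ polytope (Set.range L) ↔ ∀ i, x ∈ halfSpace (L i) := by
  simp [polytope]

theorem uniformList_eval (d n : ℕ) (i : Fin n) {A : Set (EuclideanSpace ℝ (Fin d))}
    (hA : MeasurableSet A) : uniformList d n {L | L i ∈ A} = uniformBall d A :=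
  (measurePreserving_eval (fun _ : Fin n => uniformBall d) i).measure_preimage hA.nullMeasurableSet

theorem uniformList_exists_mem_le (d n : ℕ) {A : Set (EuclideanSpace ℝ (Fin d))}
    (hA : MeasurableSet A) : uniformList d n {L | ∃ i, L i ∈ A} ≤ n * uniformBall d A := by
  rw [Set.ofPred_exists]
  refine (measure_iUnion_fintype_le _ _).trans ?_
  simp [uniformList_eval d n _ hA]

theorem uniformList_notMem_polytope_le {d n : ℕ} (x : EuclideanSpace ℝ (Fin d)) :
    uniformList d n {L | x ∉ polytope (Set.range L)} ≤
      n * uniformBall d {v | x ∉ halfSpace v} := by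
  have : {L : Fin n → EuclideanSpace ℝ (Fin d) | x ∉ polytope (Set.range L)} =
      {L | ∃ i, L i ∈ {v | x ∉ halfSpace v}} := by
    ext L
    simp [mem_polytope_range]
  rw [this]
  exact uniformList_exists_mem_le d n (isClosed_mem_halfSpace x).measurableSet.compl

theorem uniformList_mem_polytope {d n : ℕ} (x : EuclideanSpace ℝ (Fin d)) :
    uniformList d n {L | x ∈ polytope (Set.range L)} =
      (1 - uniformBall d {v | x ∉ halfSpace v}) ^ n := by
  have h : {L : Fin n → EuclideanSpace ℝ (Fin d) | x ∈ polytope (Set.range L)} =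
      Set.pi Set.univ fun _ => {v | x ∈ halfSpace v} := by
    ext L
    simp [mem_polytope_range]
  have h2 : {v | x ∉ halfSpace v} = {v | x ∈ halfSpace v}ᶜ := rfl
  rw [h, uniformList, Measure.pi_pi, h2,
    prob_compl_eq_one_sub (isClosed_mem_halfSpace x).measurableSet,
    ENNReal.sub_sub_cancel ENNReal.one_ne_top prob_le_one]
  simp

theorem uniformList_mem_polytope_le {d n : ℕ} {x : EuclideanSpace ℝ (Fin d)} {p : ℝ} (hp : 0 ≤ p)
    (h : ENNReal.ofReal p ≤ uniformBall d {v | x ∉ halfSpace v}) :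
    uniformList d n {L | x ∈ polytope (Set.range L)} ≤ ENNReal.ofReal (Real.exp (-(n * p))) := by
  have h1 : 1 - uniformBall d {v | x ∉ halfSpace v} ≤ ENNReal.ofReal (Real.exp (-p)) := by
    refine (tsub_le_tsub_left h 1).trans ?_
    rw [← ENNReal.ofReal_one, ← ENNReal.ofReal_sub _ hp]
    exact ENNReal.ofReal_le_ofReal (by linarith [Real.add_one_le_exp (-p)])
  rw [uniformList_mem_polytope]
  refine (pow_le_pow_left₀ zero_le h1 n).trans ?_
  rw [← ENNReal.ofReal_pow (Real.exp_nonneg _), ← Real.exp_nat_mul, mul_neg]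

theorem uniformList_exists_norm_lt_le (d n : ℕ) {r : ℝ} (hr : 0 ≤ r) :
    uniformList d n {L | ∃ i, ‖L i‖ < r} ≤ n * ENNReal.ofReal (r ^ d) := by
  have hA : MeasurableSet {v : EuclideanSpace ℝ (Fin d) | ‖v‖ < r} :=
    (isOpen_lt continuous_norm continuous_const).measurableSet
  refine (uniformList_exists_mem_le d n hA).trans ?_
  gcongr
  refine uniformBall_le_of_subset (c := 0) hr ?_
  rintro v ⟨-, hv⟩
  simpa using (le_of_lt hv : ‖v‖ ≤ r)

theorem uniformList_volume_cut_le {d n : ℕ} {r p : ℝ} (hr : 0 < r) (hp : 0 ≤ p)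
    (h : ∀ x : EuclideanSpace ℝ (Fin d), ‖x‖ ≤ r →
      uniformBall d {v | x ∉ halfSpace v} ≤ ENNReal.ofReal p) :
    uniformList d n {L | ENNReal.ofReal (r ^ d / 2) * volume (unitBall d) ≤
      volume {x | ‖x‖ ≤ r ∧ x ∉ polytope (Set.range L)}} ≤ ENNReal.ofReal (2 * (n * p)) := by
  have hB0 := volume_unitBall_ne_zero d
  have hBt := volume_unitBall_ne_top d
  have hr' : 0 < r ^ d / 2 := by positivity
  have hS : volume {x : EuclideanSpace ℝ (Fin d) | ‖x‖ ≤ r} =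
      ENNReal.ofReal (r ^ d) * volume (unitBall d) := by
    rw [← volume_closedBall_eq 0 hr.le]
    congr 1
    ext x
    simp
  have hScl : IsClosed {x : EuclideanSpace ℝ (Fin d) | ‖x‖ ≤ r} :=
    isClosed_le continuous_norm continuous_const
  have := measure_le_volume_section_le (uniformList d n) volume
    (T := {p | ‖p.2‖ ≤ r ∧ p.2 ∉ polytope (Set.range p.1)})
    ((hScl.measurableSet.preimage measurable_snd).inter
      (isClosed_mem_polytope_range d n).measurableSet.compl)
    hScl.measurableSet (fun q hq => hq.1) (b := ENNReal.ofReal (n * p))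
    (a := ENNReal.ofReal (r ^ d / 2) * volume (unitBall d))
    (fun x hx => by
      refine (measure_mono fun L hL => hL.2).trans ((uniformList_notMem_polytope_le x).trans ?_)
      rw [ENNReal.ofReal_mul (Nat.cast_nonneg n), ENNReal.ofReal_natCast]
      gcongr
      exact h x hx)
    (mul_ne_zero (ENNReal.ofReal_pos.2 hr').ne' hB0)
    (ENNReal.mul_ne_top ENNReal.ofReal_ne_top hBt)
  refine this.trans (le_of_eq ?_)
  rw [hS, ← mul_assoc, ENNReal.mul_div_mul_right _ _ hB0 hBt,
    ← ENNReal.ofReal_mul (by positivity), ← ENNReal.ofReal_div_of_pos hr']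
  congr 1
  field_simp

/-- Markov's inequality loses only the volume ratio of balls of radii `4 * r` and `κ / 2`, which is
exponential in `d`. -/
theorem uniformList_volume_annulus_le {d n : ℕ} {r κ p : ℝ} (hr : 0 < r) (hκ : 0 < κ) (hp : 0 ≤ p)
    (h : ∀ x : EuclideanSpace ℝ (Fin d), r ≤ ‖x‖ →
      ENNReal.ofReal p ≤ uniformBall d {v | x ∉ halfSpace v}) :
    uniformList d n {L | ENNReal.ofReal ((κ / 2) ^ d) * volume (unitBall d) ≤
      volume {x | (r ≤ ‖x‖ ∧ ‖x‖ ≤ 4 * r) ∧ x ∈ polytope (Set.range L)}} ≤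
        ENNReal.ofReal (Real.exp (-(n * p)) * (8 * r / κ) ^ d) := by
  have hB0 := volume_unitBall_ne_zero d
  have hBt := volume_unitBall_ne_top d
  have hκ' : 0 < (κ / 2) ^ d := by positivity
  have hS : volume {x : EuclideanSpace ℝ (Fin d) | r ≤ ‖x‖ ∧ ‖x‖ ≤ 4 * r} ≤
      ENNReal.ofReal ((4 * r) ^ d) * volume (unitBall d) := by
    rw [← volume_closedBall_eq 0 (by positivity)]
    refine measure_mono fun x hx => ?_
    simpa using hx.2
  have hScl : IsClosed {x : EuclideanSpace ℝ (Fin d) | r ≤ ‖x‖ ∧ ‖x‖ ≤ 4 * r} :=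
    (isClosed_le continuous_const continuous_norm).inter
      (isClosed_le continuous_norm continuous_const)
  have := measure_le_volume_section_le (uniformList d n) volume
    (T := {p | (r ≤ ‖p.2‖ ∧ ‖p.2‖ ≤ 4 * r) ∧ p.2 ∈ polytope (Set.range p.1)})
    ((hScl.measurableSet.preimage measurable_snd).inter
      (isClosed_mem_polytope_range d n).measurableSet)
    hScl.measurableSet (fun q hq => hq.1) (b := ENNReal.ofReal (Real.exp (-(n * p))))
    (a := ENNReal.ofReal ((κ / 2) ^ d) * volume (unitBall d))
    (fun x hx => (measure_mono fun L hL => hL.2).trans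
      (uniformList_mem_polytope_le hp (h x hx.1)))
    (mul_ne_zero (ENNReal.ofReal_pos.2 hκ').ne' hB0)
    (ENNReal.mul_ne_top ENNReal.ofReal_ne_top hBt)
  refine this.trans ((ENNReal.div_le_div_right (mul_le_mul_right hS _) _).trans (le_of_eq ?_))
  rw [← mul_assoc, ENNReal.mul_div_mul_right _ _ hB0 hBt,
    ← ENNReal.ofReal_mul (by positivity), ← ENNReal.ofReal_div_of_pos hκ', mul_div_assoc, ← div_pow]
  congr 3
  field_simp
  norm_num

/-! ### Limits as the dimension grows -/

open Filter Topology in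
/-- A diagonal sequence along which a family of null sequences still tends to zero. -/
theorem exists_tendsto_zero_diagonal (F : ℕ → ℝ → ENNReal)
    (hF : ∀ ε > 0, Tendsto (fun d => F d ε) atTop (𝓝 0)) :
    ∃ e : ℕ → ℝ, Tendsto e atTop (𝓝 0) ∧ Tendsto (fun d => F d (e d)) atTop (𝓝 0) := by
  classical
  let P : ℕ → ℕ → Prop := fun d k => F d (1 / ((k : ℝ) + 1)) ≤ ((k : ENNReal) + 1)⁻¹
  have hP : ∀ k, ∀ᶠ d in atTop, P d k := fun k =>
    (hF _ Nat.one_div_pos_of_nat).eventually_le_const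
      (ENNReal.inv_pos.2 (by finiteness))
  let K : ℕ → ℕ := fun d => Nat.findGreatest (P d) d
  have hK : Tendsto K atTop atTop := by
    refine tendsto_atTop.2 fun m => ?_
    filter_upwards [hP m, eventually_ge_atTop m] with d hd hmd
    exact Nat.le_findGreatest hmd hd
  -- `Nat.findGreatest` defaults to 0 when nothing qualifies, so `P d 0` is what makes its value
  -- valid.
  have hPK : ∀ᶠ d in atTop, P d (K d) := by
    filter_upwards [hP 0] with d hd
    exact Nat.findGreatest_spec (Nat.zero_le d) hd
  refine ⟨fun d => 1 / ((K d : ℝ) + 1), tendsto_one_div_add_atTop_nhds_zero_nat.comp hK, ?_⟩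
  have h0 : Tendsto (fun k : ℕ => ((k : ENNReal) + 1)⁻¹) atTop (𝓝 0) := by
    have := ENNReal.tendsto_inv_nat_nhds_zero.comp (tendsto_add_atTop_nat 1)
    simpa [Function.comp_def] using this
  exact tendsto_of_tendsto_of_tendsto_of_le_of_le' tendsto_const_nhds (h0.comp hK)
    (Eventually.of_forall fun _ => zero_le) hPK

open Filter Topology in
theorem tendsto_card_mul_pow {α b : ℝ} (hα : 1 < α) (hb : 0 ≤ b) (hαb : α * b < 1) {N : ℕ → ℕ}
    (hN : ∀ d : ℕ, |(N d : ℝ) - α ^ d| < 1) :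
    Tendsto (fun d : ℕ => (N d : ℝ) * b ^ d) atTop (𝓝 0) := by
  have h0 : Tendsto (fun d : ℕ => 2 * (α * b) ^ d) atTop (𝓝 0) := by
    simpa using (tendsto_pow_atTop_nhds_zero_of_lt_one (by positivity) hαb).const_mul 2
  refine squeeze_zero (fun d => by positivity) (fun d => ?_) h0
  have h1 := (abs_lt.1 (hN d)).2
  have h2 : 1 ≤ α ^ d := one_le_pow₀ hα.le
  rw [mul_pow, ← mul_assoc]
  gcongr
  linarith

open Filter Topology in
theorem tendsto_exp_neg_card_mul_pow {α q : ℝ} (hα : 1 < α) (hq : 0 < q) (hαq : 1 < α * q)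
    {K : ℝ} (hK : 0 < K) {N : ℕ → ℕ} (hN : ∀ d : ℕ, |(N d : ℝ) - α ^ d| < 1) :
    Tendsto (fun d : ℕ => Real.exp (-((N d : ℝ) * (q ^ d / 2))) * K ^ d) atTop (𝓝 0) := by
  -- The `1 / 4` combines `N d ≥ α ^ d / 2` with the factor in `q ^ d / 2`.
  have h1 : Tendsto (fun d : ℕ => (1 / 4 - Real.log K * ((d : ℝ) ^ 1 / (α * q) ^ d)))
      atTop (𝓝 (1 / 4)) := by
    have := ((tendsto_pow_const_div_const_pow_of_one_lt 1 hαq).const_mul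
      (Real.log K)).const_sub (1 / 4)
    rwa [mul_zero, sub_zero] at this
  have h2 := (tendsto_pow_atTop_atTop_of_one_lt hαq).atTop_mul_pos (by norm_num) h1
  refine tendsto_of_tendsto_of_tendsto_of_le_of_le' tendsto_const_nhds
    (Real.tendsto_exp_neg_atTop_nhds_zero.comp h2) (Eventually.of_forall fun d => by positivity) ?_
  filter_upwards [(tendsto_pow_atTop_atTop_of_one_lt hα).eventually_ge_atTop 2] with d hd
  have h3 := (abs_lt.1 (hN d)).1
  have h4 : α ^ d / 2 * (q ^ d / 2) ≤ N d * (q ^ d / 2) := by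
    gcongr
    linarith
  have h5 : K ^ d = Real.exp (d * Real.log K) := by
    rw [Real.exp_nat_mul, Real.exp_log hK]
  have h6 : (α * q) ^ d * (1 / 4 - Real.log K * ((d : ℝ) ^ 1 / (α * q) ^ d)) =
      (α ^ d / 2 * (q ^ d / 2)) - d * Real.log K := by
    have : (α * q) ^ d ≠ 0 := by positivity
    rw [mul_sub, pow_one]
    field_simp
    rw [mul_pow]
    ring
  rw [Function.comp_apply, h6, h5, ← Real.exp_add]
  gcongr
  linarith

open Filter Topology in
theorem eventually_four_mul_sqrt_pow_le {q η : ℝ} (hq : 0 < q) (hη : 0 < η) :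
    ∀ᶠ d : ℕ in atTop, 4 * √(q ^ 2 - η ^ 2) ^ d ≤ q ^ d := by
  have hlt : √(q ^ 2 - η ^ 2) < q := (Real.sqrt_lt' hq).2 (by nlinarith)
  have h := tendsto_pow_atTop_nhds_zero_of_lt_one
    (div_nonneg (Real.sqrt_nonneg (q ^ 2 - η ^ 2)) hq.le) ((div_lt_one hq).2 hlt)
  filter_upwards [h.eventually_le_const (show (0 : ℝ) < 1 / 4 by norm_num)] with d hd
  rw [div_pow, div_le_iff₀ (by positivity)] at hd
  linarith

open Filter Topology in
/-- Strict versions of the inequalities that place a slab of radius larger than `a` in a lens. -/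
theorem exists_slab_parameters {a ρ s₀ r : ℝ} (hs₀ : 0 < s₀)
    (h1 : s₀ ^ 2 + a ^ 2 ≤ 1) (h2 : s₀ ^ 2 + a ^ 2 ≤ 2 * ρ * s₀) (hr : ρ < r) :
    ∃ s q η : ℝ, 0 < s ∧ a < q ∧ 0 < η ∧ η ≤ s ∧ q ^ 2 + 2 * s * η + s ^ 2 ≤ 1 ∧
      q ^ 2 + 2 * s * η + s ^ 2 < 2 * r * (s - η) := by
  -- Lowering `s` slightly makes `h1` strict; the slack `ρ < r` in `h2` absorbs the change.
  have hs : ∃ s, 0 < s ∧ s < s₀ ∧ s ^ 2 + a ^ 2 < 2 * r * s := by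
    have hlt : s₀ ^ 2 + a ^ 2 < 2 * r * s₀ := h2.trans_lt (by gcongr)
    have e1 : ∀ᶠ s in 𝓝 s₀, s ^ 2 + a ^ 2 < 2 * r * s :=
      ContinuousAt.eventually_lt (by fun_prop) (by fun_prop) hlt
    have e2 : ∀ᶠ s in 𝓝 s₀, 0 < s := lt_mem_nhds hs₀
    have e3 : ∀ᶠ s in 𝓝[<] s₀, s < s₀ := self_mem_nhdsWithin
    obtain ⟨s, hs⟩ := ((e1.and e2).filter_mono nhdsWithin_le_nhds |>.and e3).exists
    exact ⟨s, hs.1.2, hs.2, hs.1.1⟩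
  obtain ⟨s, hs, hss₀, hlt⟩ := hs
  have hlt1 : s ^ 2 + a ^ 2 < 1 := by nlinarith
  have e1 : ∀ᶠ η in 𝓝 (0 : ℝ), (a + η) ^ 2 + 2 * s * η + s ^ 2 < 1 :=
    ContinuousAt.eventually_lt (by fun_prop) (by fun_prop) (by simpa [add_comm] using hlt1)
  have e2 : ∀ᶠ η in 𝓝 (0 : ℝ), (a + η) ^ 2 + 2 * s * η + s ^ 2 < 2 * r * (s - η) :=
    ContinuousAt.eventually_lt (by fun_prop) (by fun_prop) (by simpa [add_comm] using hlt)
  have e3 : ∀ᶠ η in 𝓝 (0 : ℝ), η < s := gt_mem_nhds hs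
  have e4 : ∀ᶠ η in 𝓝[>] (0 : ℝ), 0 < η := self_mem_nhdsWithin
  obtain ⟨η, hη⟩ := (((e1.and e2).and e3).filter_mono nhdsWithin_le_nhds |>.and e4).exists
  exact ⟨s, a + η, η, hs, by linarith [hη.2], hη.2, hη.1.2.le, hη.1.1.1.le, hη.1.1.2⟩

/-! ### The threshold radius and the two regimes -/

open Filter Topology in
-- The hypotheses say that the lens at radius `ρ` has cross-section `1/α`: `h1` and `h2` bound it
-- from below, `h3` from above. Moving to `r₀ < ρ < r₁` makes both comparisons strict.
theorem tendsto_uniformList_not_volumeIsPow {α : ℝ} (hα : 1 < α) {N : ℕ → ℕ}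
    (hN : ∀ d : ℕ, |(N d : ℝ) - α ^ d| < 1) {ρ s₀ t : ℝ} (hρ : 0 < ρ) (hs₀ : 0 < s₀)
    (ht0 : 0 < t) (ht1 : t ≤ 1) (h1 : s₀ ^ 2 + (1 / α) ^ 2 ≤ 1)
    (h2 : s₀ ^ 2 + (1 / α) ^ 2 ≤ 2 * ρ * s₀) (h3 : 1 - t + t ^ 2 * ρ ^ 2 ≤ (1 / α) ^ 2)
    {ε : ℝ} (hε : 0 < ε) :
    Tendsto (fun d : ℕ => uniformList d (N d) {L | ¬ VolumeIsPow (ρ ^ 2) (ε * d) (Set.range L)})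
      atTop (𝓝 0) := by
  have hα0 : 0 < α := by linarith
  set r₀ := ρ * Real.exp (-(ε / 2)) with hr₀
  set r₁ := ρ * Real.exp (ε / 2) with hr₁
  have hr₀0 : 0 < r₀ := by positivity
  have hr₁0 : 0 < r₁ := by positivity
  have hr₀ρ : r₀ < ρ := mul_lt_of_lt_one_right hρ (by rw [Real.exp_lt_one_iff]; linarith)
  have hr₁ρ : ρ < r₁ := lt_mul_of_one_lt_right hρ (Real.one_lt_exp_iff.2 (by linarith))
  obtain ⟨s, q, η, hs, hq, hη, hηs, hslab1, hslab2⟩ := exists_slab_parameters hs₀ h1 h2 hr₁ρ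
  have hq0 : 0 < q := lt_trans (by positivity) hq
  have hαq : 1 < α * q := by
    rwa [div_lt_iff₀' hα0] at hq
  set β := √(1 - t + t ^ 2 * r₀ ^ 2)
  have hβ0 : 0 ≤ β := Real.sqrt_nonneg _
  have hβ : α * β < 1 := by
    rw [← lt_div_iff₀' hα0]
    refine (Real.sqrt_lt' (by positivity)).2 (lt_of_lt_of_le ?_ h3)
    gcongr
  -- So small that with high probability no point has norm below `2 * κ`.
  set κ := min r₁ (1 / (4 * α))
  have hκ0 : 0 < κ := lt_min hr₁0 (by positivity)
  have hκr : κ ≤ r₁ := min_le_left _ _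
  have hκα : α * (2 * κ) < 1 := by
    have : κ ≤ 1 / (4 * α) := min_le_right _ _
    rw [le_div_iff₀ (by positivity)] at this
    linarith
  have t1 : Tendsto (fun d : ℕ => ENNReal.ofReal (N d * (2 * κ) ^ d)) atTop (𝓝 0) := by
    simpa using ENNReal.tendsto_ofReal (tendsto_card_mul_pow hα (by positivity) hκα hN)
  have t2 : Tendsto (fun d : ℕ => ENNReal.ofReal (2 * (N d * β ^ d))) atTop (𝓝 0) := by
    simpa using ENNReal.tendsto_ofReal ((tendsto_card_mul_pow hα hβ0 hβ hN).const_mul 2)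
  have t3 : Tendsto (fun d : ℕ =>
      ENNReal.ofReal (Real.exp (-(N d * (q ^ d / 2))) * (8 * r₁ / κ) ^ d)) atTop (𝓝 0) := by
    simpa using ENNReal.tendsto_ofReal
      (tendsto_exp_neg_card_mul_pow hα hq0 hαq (K := 8 * r₁ / κ) (by positivity) hN)
  have t123 := (t1.add t2).add t3
  rw [add_zero, add_zero] at t123
  have hlog : ∀ᶠ d : ℕ in atTop, Real.log 2 ≤ ε / 2 * d :=
    (tendsto_natCast_atTop_atTop.const_mul_atTop (half_pos hε)).eventually_ge_atTop _
  refine tendsto_of_tendsto_of_tendsto_of_le_of_le' tendsto_const_nhds t123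
    (Eventually.of_forall fun _ => zero_le) ?_
  filter_upwards [hlog, eventually_four_mul_sqrt_pow_le hq0 hη] with d hd hslab
  have b1 := uniformList_exists_norm_lt_le d (N d) (r := 2 * κ) (by positivity)
  rw [← ENNReal.ofReal_natCast, ← ENNReal.ofReal_mul (Nat.cast_nonneg _)] at b1
  have b2 := uniformList_volume_cut_le (d := d) (n := N d) hr₀0 (pow_nonneg hβ0 d)
    fun x hx => uniformBall_cut_le ht0.le ht1 hx
  have b3 := uniformList_volume_annulus_le (d := d) (n := N d) (p := q ^ d / 2) hr₁0 hκ0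
    (by positivity) fun x hx =>
      le_uniformBall_cut hs.le hq0.le hη.le hηs hr₁0 hslab1 hslab2 hslab hx
  refine le_trans (measure_mono ?_) ((measure_union_le _ _).trans
    (add_le_add ((measure_union_le _ _).trans (add_le_add b1 b2)) b3))
  intro L hL
  by_contra hgood
  simp only [Set.mem_union, Set.mem_ofPred_eq, not_or, not_exists, not_lt, not_le] at hgood
  obtain ⟨⟨g1, g2⟩, g3⟩ := hgood
  refine hL ((volumeIsPow_of_bounds (ε := ε / 2) hρ ?_ ?_).mono (by linarith))
  · exact volume_polytope_ge hr₀0.le g2.le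
  · exact volume_polytope_le hκ0 hκr (Set.forall_mem_range.2 g1) g3

open Filter Topology in
theorem exists_isLittleO_tendsto_volumeIsPow {α : ℝ} (hα : 1 < α) {N : ℕ → ℕ}
    (hN : ∀ d : ℕ, |(N d : ℝ) - α ^ d| < 1) {ρ s₀ t : ℝ} (hρ : 0 < ρ) (hs₀ : 0 < s₀)
    (ht0 : 0 < t) (ht1 : t ≤ 1) (h1 : s₀ ^ 2 + (1 / α) ^ 2 ≤ 1)
    (h2 : s₀ ^ 2 + (1 / α) ^ 2 ≤ 2 * ρ * s₀) (h3 : 1 - t + t ^ 2 * ρ ^ 2 ≤ (1 / α) ^ 2) :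
    ∃ δ : ℕ → ℝ, δ =o[atTop] (fun d : ℕ => (d : ℝ)) ∧
      Tendsto (fun d : ℕ => uniformList d (N d)
        {L | VolumeIsPow (ρ ^ 2) (δ d) (Set.range L)}) atTop (𝓝 1) := by
  obtain ⟨e, he, hlim⟩ := exists_tendsto_zero_diagonal
    (fun d ε => uniformList d (N d) {L | ¬ VolumeIsPow (ρ ^ 2) (ε * d) (Set.range L)})
    fun ε hε => tendsto_uniformList_not_volumeIsPow hα hN hρ hs₀ ht0 ht1 h1 h2 h3 hε
  refine ⟨fun d => e d * d, ?_, ?_⟩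
  · simpa using ((Asymptotics.isLittleO_one_iff ℝ).2 he).mul_isBigO
      (Asymptotics.isBigO_refl (fun d : ℕ => (d : ℝ)) atTop)
  · have hsub := ENNReal.Tendsto.sub (tendsto_const_nhds (x := (1 : ENNReal))) hlim
      (Or.inl ENNReal.one_ne_top)
    rw [tsub_zero] at hsub
    refine tendsto_of_tendsto_of_tendsto_of_le_of_le hsub tendsto_const_nhds (fun d => ?_)
      fun d => prob_le_one
    -- Subadditivity suffices here, so the event need not be measurable.
    rw [tsub_le_iff_right, ← measure_univ (μ := uniformList d (N d))]
    refine (measure_mono fun L _ => ?_).trans (measure_union_le _ _)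
    exact em _

theorem theorem3p2 (α : ℝ) (hα : 1 < α) (N : ℕ → ℕ)
    (hN : ∀ d : ℕ, |(N d : ℝ) - α ^ d| < 1) :
    (α ≤ Real.sqrt 2 →
      ∃ δ : ℕ → ℝ, δ =o[Filter.atTop] (fun d : ℕ => (d : ℝ)) ∧
        Filter.Tendsto
          (fun d : ℕ => uniformList d (N d)
            {L | VolumeIsPow (α ^ 2 / (4 * α ^ 2 - 4)) (δ d) (Set.range L)})
          Filter.atTop (nhds 1)) ∧
    (Real.sqrt 2 ≤ α →
      ∃ δ : ℕ → ℝ, δ =o[Filter.atTop] (fun d : ℕ => (d : ℝ)) ∧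
        Filter.Tendsto
          (fun d : ℕ => uniformList d (N d)
            {L | VolumeIsPow (1 / α ^ 2) (δ d) (Set.range L)})
          Filter.atTop (nhds 1)) := by
  have hα0 : 0 < α := by linarith
  have hα2 : 0 < α ^ 2 - 1 := by nlinarith
  constructor
  · intro h
    have h2 : α ^ 2 ≤ 2 := by
      have := Real.sq_sqrt (show (0 : ℝ) ≤ 2 by norm_num)
      nlinarith
    have hc : 0 < α ^ 2 / (4 * α ^ 2 - 4) := div_pos (by positivity) (by linarith)
    set ρ := √(α ^ 2 / (4 * α ^ 2 - 4))
    have hρ : 0 < ρ := Real.sqrt_pos.2 hc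
    have hρ2 : ρ ^ 2 = α ^ 2 / (4 * α ^ 2 - 4) := Real.sq_sqrt hc.le
    have hne : α ^ 2 - 1 ≠ 0 := hα2.ne'
    have hne4 : 4 * α ^ 2 - 4 ≠ 0 := by linarith
    have hs : (1 / (2 * ρ)) ^ 2 + (1 / α) ^ 2 = 1 := by
      rw [div_pow, mul_pow, hρ2]
      field_simp
      ring
    have h2ρ : 2 * ρ * (1 / (2 * ρ)) = 1 := by field_simp
    have key : 1 / (4 * ρ ^ 2) = 1 - (1 / α) ^ 2 := by
      have : 1 / (4 * ρ ^ 2) = (1 / (2 * ρ)) ^ 2 := by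
        field_simp
        norm_num
      linarith
    rw [← hρ2]
    -- The two spheres bounding the lens meet at height `1 / (2 * ρ)`; `t = 1 / (2 * ρ ^ 2)`
    -- minimizes `1 - t + t ^ 2 * ρ ^ 2`, and `t ≤ 1` amounts to `α ^ 2 ≤ 2`.
    refine exists_isLittleO_tendsto_volumeIsPow hα hN hρ (s₀ := 1 / (2 * ρ))
      (t := 1 / (2 * ρ ^ 2)) (by positivity) (by positivity) ?_ hs.le (by rw [hs, h2ρ]) ?_
    · rw [div_le_one (by positivity), hρ2, ← mul_div_assoc, one_le_div (by linarith)]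
      linarith
    · have : 1 - 1 / (2 * ρ ^ 2) + (1 / (2 * ρ ^ 2)) ^ 2 * ρ ^ 2 = 1 - 1 / (4 * ρ ^ 2) := by
        field_simp
        ring
      rw [this, key]
      linarith
  · intro h
    have h2 : 2 ≤ α ^ 2 := by
      have := Real.sq_sqrt (show (0 : ℝ) ≤ 2 by norm_num)
      nlinarith [Real.sqrt_nonneg 2]
    have hinv : (1 / α) ^ 2 ≤ 1 / 2 := by
      rw [div_pow, one_pow]
      exact one_div_le_one_div_of_le two_pos h2
    rw [show 1 / α ^ 2 = (1 / α) ^ 2 by rw [div_pow, one_pow]]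
    -- Here `ρ = s₀ = 1 / α`: the widest cross-section passes through `x` itself, so both comparison
    -- balls are centred at `x`.
    exact exists_isLittleO_tendsto_volumeIsPow hα hN (s₀ := 1 / α) (t := 1) (by positivity)
      (by positivity) one_pos le_rfl (by linarith) (by linarith) (by linarith)
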